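/- Let $n,m,p\ge 0$ be integers and let $S$ be the real discrete-time linear system $$x_{k+1}=Ax_k+Bu_k,\qquad y_k=Cx_k+Du_k,\qquad x_k\in\mathbb R^n,\ u_k\in\mathbb R^m,\ y_k\in\mathbb R^p .$$ Assume that $S$ is minimal, i.e. $(A,C)$ is observable and $(A,B)$ is controllable, and that $S$ has an $L_0$-delay left inverse for some $L_0\le n$, i.e. for a given state $x_k$ the outputs $y_k,\dots,y_{k+L_0}$ determine $u_k$ uniquely. A number $z\in\mathbb C$ is an invariant zero of $S$ if $\operatorname{rank}\begin{bmatrix}A-zI&B\\C&D\end{bmatrix}<n+m$. Let $N\ge n$, $L\ge L_0$ and $T\ge 0$ be integers and let $u^d=(u_0,\dots,u_{T+N+L})$, $y^d=(y_0,\dots,y_{T+N+L})$ be the input and the output of a trajectory of $S$. For a signal $w=(w_0,\dots,w_{T+N+L})$ let $\mathcal H_t(w)$ be the block Hankel matrix with $t$ block rows, whose block in position $(i,j)$, $0\le i<t$, $0\le j\le T+N+L+1-t$, is $w_{i+j}$. Assume that $u^d$ is persistently exciting of order $n+N+L+1$, i.e. $\mathcal H_{n+N+L+1}(u^d)$ has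 full row rank. Put $Y=\mathcal H_{N+L+1}(y^d)$, let $U_p$ consist of the first $N$ block rows of $\mathcal H_{N+L+1}(u^d)$ and let $U_f$ be its next block row. Let $M^\dagger$ denote the Moore–Penrose inverse of a real matrix $M$, let $\Pi=I-Y^\dagger Y$, and let $M_u=U_f\Pi(U_p\Pi)^\dagger\in\mathbb R^{m\times mN}$. Let $$R=\begin{bmatrix}0&I_m&&\\&&\ddots&\\0&0&&I_m\\ \multicolumn{4}{c}{M_u}\end{bmatrix}\in\mathbb R^{mN\times mN}$$ be the block companion matrix with last block row $M_u$; it is the matrix that propagates the errors $(\hat u_{k-N}-u_{k-N},\dots,\hat u_{k-1}-u_{k-1})$ of the constrained-least-squares input estimator $\hat u_k=U_fg^\star$, where $g^\star=Y^\dagger y_{k-N:k+L}+\Pi(U_p\Pi)^\dagger(\hat u_{k-N:k-1}-U_pY^\dagger y_{k-N:k+L})$ minimizes $\|U_pg-\hat u_{k-N:k-1}\|_2^2$ subject to $Yg=y_{k-N:k+L}$. Then $R$ is Schur stable (all its complex eigenvalues lie strictly inside the unit circle) if and only if every invariant zero of $S$ lies strictly inside the unit circle. Moreover, the set of complex eigenvalues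 of $R$ is the union of the set of invariant zeros of $S$ and a set of numbers of modulus strictly smaller than $1$. -/

import Mathlib

open Matrix

noncomputable section

namespace InputEstimation

/-! ### The Moore-Penrose inverse of a real matrix -/

/-- The four Penrose equations: `G` is the Moore-Penrose inverse of `M`. -/
structure IsMoorePenroseInverse {ι κ : Type*} [Fintype ι] [Fintype κ]
    (M : Matrix ι κ ℝ) (G : Matrix κ ι ℝ) : Prop where
  mul_mul_self : M * G * M = M
  inv_mul_mul : G * M * G = G
  symm_left : (M * G)ᵀ = M * G
  symm_right : (G * M)ᵀ = G * M

theorem exists_isMoorePenroseInverse {ι κ : Type*} [Fintype ι] [Fintype κ]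
    (M : Matrix ι κ ℝ) : ∃ G : Matrix κ ι ℝ, IsMoorePenroseInverse M G := by
  classical
  have hH : (Mᵀ * M).IsHermitian := by
    simpa [conjTranspose_eq_transpose_of_trivial] using isHermitian_conjTranspose_mul_self M
  obtain ⟨U, d, hU, hU', hS⟩ : ∃ (U : Matrix κ κ ℝ) (d : κ → ℝ),
      Uᵀ * U = 1 ∧ U * Uᵀ = 1 ∧ Mᵀ * M = U * diagonal d * Uᵀ := by
    refine ⟨hH.eigenvectorUnitary, hH.eigenvalues, ?_, ?_, ?_⟩
    · simpa [star_eq_conjTranspose, conjTranspose_eq_transpose_of_trivial]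
        using Unitary.coe_star_mul_self hH.eigenvectorUnitary
    · simpa [star_eq_conjTranspose, conjTranspose_eq_transpose_of_trivial]
        using Unitary.coe_mul_star_self hH.eigenvectorUnitary
    · have h := hH.spectral_theorem
      simpa [Unitary.conjStarAlgAut_apply, star_eq_conjTranspose,
        conjTranspose_eq_transpose_of_trivial, Function.comp_def] using h
  set E : Matrix κ κ ℝ := diagonal (fun i => (d i)⁻¹) with hE
  set Q : Matrix κ κ ℝ := U * (E * diagonal d) * Uᵀ with hQ
  set K : Matrix κ κ ℝ := U * E * Uᵀ with hK
  have cancel : ∀ X Y : Matrix κ κ ℝ, (U * X * Uᵀ) * (U * Y * Uᵀ) = U * (X * Y) * Uᵀ := by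
    intro X Y
    calc (U * X * Uᵀ) * (U * Y * Uᵀ) = U * X * (Uᵀ * U) * Y * Uᵀ := by
          simp only [Matrix.mul_assoc]
      _ = _ := by rw [hU]; simp only [Matrix.mul_one, Matrix.mul_assoc]
  have hKS : K * (Mᵀ * M) = Q := by rw [hS, hK, cancel]
  have hQt : Qᵀ = Q := by
    simp [hQ, hE, Matrix.transpose_mul, Matrix.mul_assoc, diagonal_mul_diagonal]
  have hKt : Kᵀ = K := by simp [hK, hE, Matrix.transpose_mul, Matrix.mul_assoc]
  have hQK : Q * K = K := by
    rw [hQ, hK, cancel, hE, diagonal_mul_diagonal, diagonal_mul_diagonal]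
    congr 3
    ext i
    by_cases h : d i = 0 <;> simp [h]
  have hSQ : (Mᵀ * M) * Q = Mᵀ * M := by
    rw [hS, hQ, cancel, hE, diagonal_mul_diagonal, diagonal_mul_diagonal]
    congr 3
    ext i
    by_cases h : d i = 0 <;> simp [h]
  have hMQ : M * Q = M := by
    have h0 : (M * Q - M)ᴴ * (M * Q - M) = 0 := by
      rw [conjTranspose_eq_transpose_of_trivial, transpose_sub, transpose_mul, Matrix.sub_mul,
        Matrix.mul_assoc, Matrix.mul_sub, ← Matrix.mul_assoc, hSQ]
      simp
    exact sub_eq_zero.mp (conjTranspose_mul_self_eq_zero.mp h0)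
  refine ⟨K * Mᵀ, ?_, ?_, ?_, ?_⟩
  · rw [Matrix.mul_assoc, Matrix.mul_assoc, hKS, hMQ]
  · rw [Matrix.mul_assoc K, hKS, ← Matrix.mul_assoc, hQK]
  · simp [Matrix.transpose_mul, hKt, Matrix.mul_assoc]
  · rw [Matrix.mul_assoc, hKS, hQt]

/-- The Penrose equations have at most one solution. -/
theorem IsMoorePenroseInverse.unique {ι κ : Type*} [Fintype ι] [Fintype κ]
    {M : Matrix ι κ ℝ} {G H : Matrix κ ι ℝ}
    (hG : IsMoorePenroseInverse M G) (hH : IsMoorePenroseInverse M H) : G = H := by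
  have h1 : M * G = M * H := by
    calc M * G = (M * H) * (M * G) := by
          rw [← Matrix.mul_assoc, hH.mul_mul_self]
      _ = ((M * G) * (M * H))ᵀ := by
          rw [transpose_mul, hG.symm_left, hH.symm_left]
      _ = (M * H)ᵀ := by rw [← Matrix.mul_assoc, hG.mul_mul_self]
      _ = M * H := hH.symm_left
  have h2 : G * M = H * M := by
    calc G * M = (G * M) * (H * M) := by
          rw [Matrix.mul_assoc, ← Matrix.mul_assoc M, hH.mul_mul_self]
      _ = ((H * M) * (G * M))ᵀ := by
          rw [transpose_mul, hG.symm_right, hH.symm_right]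
      _ = (H * M)ᵀ := by rw [Matrix.mul_assoc, ← Matrix.mul_assoc M, hG.mul_mul_self]
      _ = H * M := hH.symm_right
  calc G = G * M * G := hG.inv_mul_mul.symm
    _ = H * M * H := by rw [h2, Matrix.mul_assoc, h1, ← Matrix.mul_assoc]
    _ = H := hH.inv_mul_mul

/-- The Moore-Penrose inverse of a real matrix. -/
def pinv {ι κ : Type*} [Fintype ι] [Fintype κ] (M : Matrix ι κ ℝ) : Matrix κ ι ℝ :=
  (exists_isMoorePenroseInverse M).choose

theorem pinv_spec {ι κ : Type*} [Fintype ι] [Fintype κ] (M : Matrix ι κ ℝ) :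
    IsMoorePenroseInverse M (pinv M) :=
  (exists_isMoorePenroseInverse M).choose_spec

/-! ### Linear time-invariant systems -/

/-- The discrete-time system `x⁺ = A x + B u`, `y = C x + D u` with `n` states, `m` inputs and
`p` outputs. -/
structure LTISystem (n m p : ℕ) where
  A : Matrix (Fin n) (Fin n) ℝ
  B : Matrix (Fin n) (Fin m) ℝ
  C : Matrix (Fin p) (Fin n) ℝ
  D : Matrix (Fin p) (Fin m) ℝ

namespace LTISystem

variable {n m p : ℕ} (S : LTISystem n m p)

/-- `x`, `u`, `y` are the state, input and output at the times `0, …, ℓ - 1` along a trajectory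
of the system. -/
def IsTrajectory {ℓ : ℕ} (x : Fin ℓ → Fin n → ℝ) (u : Fin ℓ → Fin m → ℝ)
    (y : Fin ℓ → Fin p → ℝ) : Prop :=
  (∀ (k : ℕ) (hk : k + 1 < ℓ),
      x ⟨k + 1, hk⟩ = S.A *ᵥ x ⟨k, by omega⟩ + S.B *ᵥ u ⟨k, by omega⟩) ∧
    ∀ k : Fin ℓ, y k = S.C *ᵥ x k + S.D *ᵥ u k

/-- The observability matrix with block rows `C, C A, …, C A ^ (n - 1)`. -/
def observabilityMatrix : Matrix (Fin n × Fin p) (Fin n) ℝ :=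
  fun r j => (S.C * S.A ^ (r.1 : ℕ)) r.2 j

/-- The controllability matrix with block columns `B, A B, …, A ^ (n - 1) B`. -/
def controllabilityMatrix : Matrix (Fin n) (Fin n × Fin m) ℝ :=
  fun i c => (S.A ^ (c.1 : ℕ) * S.B) i c.2

/-- The pair `(A, C)` is observable. -/
def IsObservable : Prop := S.observabilityMatrix.rank = n

/-- The pair `(A, B)` is controllable. -/
def IsControllable : Prop := S.controllabilityMatrix.rank = n

/-- The system is minimal. -/
def IsMinimal : Prop := S.IsObservable ∧ S.IsControllable

/-- An `L`-delay left inverse exists: given the initial state, the outputs at the times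
`0, …, L` determine the input at time `0`. -/
def IsDelayInvertible (L : ℕ) : Prop :=
  ∀ (x x' : Fin (L + 1) → Fin n → ℝ) (u u' : Fin (L + 1) → Fin m → ℝ)
    (y : Fin (L + 1) → Fin p → ℝ),
    S.IsTrajectory x u y → S.IsTrajectory x' u' y → x 0 = x' 0 → u 0 = u' 0

/-- The Rosenbrock system matrix at `z`, with blocks `A - z I`, `B`, `C`, `D`. -/
def systemMatrix (z : ℂ) : Matrix (Fin n ⊕ Fin p) (Fin n ⊕ Fin m) ℂ :=
  fromBlocks (S.A.map Complex.ofReal - z • 1) (S.B.map Complex.ofReal)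
    (S.C.map Complex.ofReal) (S.D.map Complex.ofReal)

/-- `z` is an invariant zero of the system. -/
def IsInvariantZero (z : ℂ) : Prop := (S.systemMatrix z).rank < n + m

end LTISystem

/-! ### Offline data -/

/-- The block Hankel matrix with `t` block rows of the signal `w 0, …, w (ℓ - 1)`: its block at
position `(i, j)` is `w (i + j)`. -/
def hankel {ℓ d : ℕ} (t : ℕ) (w : Fin ℓ → Fin d → ℝ) :
    Matrix (Fin t × Fin d) (Fin (ℓ + 1 - t)) ℝ :=
  fun r j => w ⟨r.1 + j, by omega⟩ r.2

/-- Persistency of excitation of order `t`: the Hankel matrix with `t` block rows has full row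
rank. -/
def PersistentlyExciting {ℓ d : ℕ} (t : ℕ) (w : Fin ℓ → Fin d → ℝ) : Prop :=
  (hankel t w).rank = t * d

/-- The first `N` block rows (the past) of the Hankel matrix with `N + L + 1` block rows. -/
def pastRows {ℓ d : ℕ} (N L : ℕ) (w : Fin ℓ → Fin d → ℝ) :
    Matrix (Fin N × Fin d) (Fin (ℓ + 1 - (N + L + 1))) ℝ :=
  fun r j => hankel (N + L + 1) w (⟨r.1, by omega⟩, r.2) j

/-- The block row of index `N` (the present, preceded by `N` block rows) of the Hankel matrix with
`N + L + 1` block rows. -/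
def presentRow {ℓ d : ℕ} (N L : ℕ) (w : Fin ℓ → Fin d → ℝ) :
    Matrix (Fin d) (Fin (ℓ + 1 - (N + L + 1))) ℝ :=
  fun a j => hankel (N + L + 1) w (⟨N, by omega⟩, a) j

/-! ### The estimator and its error propagation -/

/-- The orthogonal projector `I - M† M` onto the kernel of `M`. -/
def kerProj {ι κ : Type*} [Fintype ι] [Fintype κ] [DecidableEq κ] (M : Matrix ι κ ℝ) :
    Matrix κ κ ℝ :=
  1 - pinv M * M

/-- The gain `M_u = U_f Π (U_p Π)†`, where `Π` is the orthogonal projector onto the kernel of the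
output Hankel matrix. -/
def inputGain {ℓ m p : ℕ} (N L : ℕ) (u : Fin ℓ → Fin m → ℝ) (y : Fin ℓ → Fin p → ℝ) :
    Matrix (Fin m) (Fin N × Fin m) ℝ :=
  presentRow N L u * kerProj (hankel (N + L + 1) y) *
    pinv (pastRows N L u * kerProj (hankel (N + L + 1) y))

/-- The block companion matrix whose last block row is `G` and whose other block rows shift the
block entries by one. -/
def blockCompanion {N m : ℕ} (G : Matrix (Fin m) (Fin N × Fin m) ℝ) :
    Matrix (Fin N × Fin m) (Fin N × Fin m) ℝ :=
  fun r c =>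
    if (r.1 : ℕ) + 1 < N then
      if (c.1 : ℕ) = r.1 + 1 ∧ c.2 = r.2 then 1 else 0
    else G r.2 c

/-- The error-propagation matrix `R` of the input estimator. -/
def errorMatrix {ℓ m p : ℕ} (N L : ℕ) (u : Fin ℓ → Fin m → ℝ) (y : Fin ℓ → Fin p → ℝ) :
    Matrix (Fin N × Fin m) (Fin N × Fin m) ℝ :=
  blockCompanion (inputGain N L u y)

/-- The set of complex eigenvalues of a real square matrix. -/
def eigenvalueSet {ι : Type*} [Fintype ι] [DecidableEq ι] (M : Matrix ι ι ℝ) : Set ℂ :=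
  spectrum ℂ (M.map Complex.ofReal)

/-- All eigenvalues lie strictly inside the unit circle. -/
def IsSchurStable {ι : Type*} [Fintype ι] [DecidableEq ι] (M : Matrix ι ι ℝ) : Prop :=
  ∀ z ∈ eigenvalueSet M, ‖z‖ < 1

end InputEstimation

end

open InputEstimation

namespace InputEstimation

/-! ### Linear algebra: rank criteria, and eigenvectors of a matrix that is contractive off an
invariant subspace. -/

section LinearAlgebra

variable {K ι κ : Type*} [Field K] [Fintype ι] [Fintype κ]

/-! Let `V` be the space of past inputs (the first `N` samples) of trajectories of length `N + L +
1` with zero output. By the fundamental lemma these trajectories are exactly the data combinations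
with weights in the kernel of `Y`, so `V` is the range of `U_p Π` and `pastProj` is the orthogonal
projector onto it.

On `V` the gain returns the true present input (`inputGain_mulVec_pastRows`): past inputs and zero
output fix the initial state by observability, and the delayed inverse then fixes all inputs up to
time `N`. Hence `R` acts on `V` as the time shift of zero-output trajectories. It maps `V` into
itself because zero output maintained for at least `n` steps can be maintained for one more from the
same initial state. On the orthogonal complement of `V` the gain vanishes, so `R` there is a plain
block shift, which is contractive and nilpotent.

An invariant zero `z` gives the zero-output trajectory `z ^ k (x, u)`, whose past inputs form an
eigenvector of `R`. Conversely, for `1 ≤ ‖z‖` contractivity and nilpotency force an eigenvector into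
`V` (`mulVec_eq_self_of_one_le_norm`). Comparing its trajectory with its own shift yields a kernel
vector of the system matrix, so `z` is an invariant zero. -/

theorem eq_zero_of_vecMul_eq_zero {M : Matrix ι κ K} (h : M.rank = Fintype.card ι)
    {v : ι → K} (hv : v ᵥ* M = 0) : v = 0 := by
  have hli : LinearIndependent K M.row := by
    rw [linearIndependent_iff_card_eq_finrank_span, ← h, M.rank_eq_finrank_span_row]
    rfl
  exact (Matrix.vecMul_injective_iff.mpr hli) (by simpa using hv)

theorem rank_eq_card_rows_of_vecMul {M : Matrix ι κ K} (h : ∀ v : ι → K, v ᵥ* M = 0 → v = 0) :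
    M.rank = Fintype.card ι := by
  have hinj : Function.Injective M.vecMul := by
    intro a b hab
    refine sub_eq_zero.mp (h _ ?_)
    rw [sub_vecMul, sub_eq_zero]
    exact hab
  exact (Matrix.vecMul_injective_iff.mp hinj).rank_matrix

theorem mulVec_surjective_of_vecMul {M : Matrix ι κ K} (h : ∀ v : ι → K, v ᵥ* M = 0 → v = 0)
    (b : ι → K) : ∃ g : κ → K, M *ᵥ g = b := by
  have hr := rank_eq_card_rows_of_vecMul h
  have htop : LinearMap.range M.mulVecLin = ⊤ := by
    apply Submodule.eq_top_of_finrank_eq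
    rw [Module.finrank_fintype_fun_eq_card, ← hr]
    rfl
  obtain ⟨g, hg⟩ := LinearMap.range_eq_top.mp htop b
  exact ⟨g, hg⟩

theorem eq_zero_of_mulVec_eq_zero {M : Matrix ι κ K} (h : M.rank = Fintype.card κ)
    {v : κ → K} (hv : M *ᵥ v = 0) : v = 0 := by
  apply eq_zero_of_vecMul_eq_zero (M := Mᵀ) (by rw [Matrix.rank_transpose, h])
  rwa [vecMul_transpose]

theorem rank_lt_card_iff_exists_mulVec_eq_zero {M : Matrix ι κ K} :
    M.rank < Fintype.card κ ↔ ∃ v : κ → K, v ≠ 0 ∧ M *ᵥ v = 0 := by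
  constructor
  · intro h
    by_contra! hc
    apply h.ne
    rw [← Matrix.rank_transpose]
    apply rank_eq_card_rows_of_vecMul
    intro v hv
    by_contra hne
    exact hc v hne (by rwa [vecMul_transpose] at hv)
  · rintro ⟨v, hne, hv⟩
    exact lt_of_le_of_ne M.rank_le_card_width fun h => hne (eq_zero_of_mulVec_eq_zero h hv)

theorem mem_spectrum_iff_exists_mulVec_eq_smul [DecidableEq ι] {M : Matrix ι ι K} {z : K} :
    z ∈ spectrum K M ↔ ∃ v : ι → K, v ≠ 0 ∧ M *ᵥ v = z • v := by
  rw [← Matrix.spectrum_toLin', ← Module.End.hasEigenvalue_iff_mem_spectrum]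
  constructor
  · intro h
    obtain ⟨v, hv⟩ := h.exists_hasEigenvector
    exact ⟨v, hv.2, by simpa using hv.apply_eq_smul⟩
  · rintro ⟨v, hne, hv⟩
    exact Module.End.hasEigenvalue_of_hasEigenvector
      (Module.End.hasEigenvector_iff.mpr ⟨Module.End.mem_eigenspace_iff.mpr (by simpa using hv), hne⟩)

theorem re_map_ofReal_mulVec {ι κ : Type*} [Fintype κ] (M : Matrix ι κ ℝ) (v : κ → ℂ) (i : ι) :
    ((M.map Complex.ofReal *ᵥ v) i).re = (M *ᵥ fun j => (v j).re) i := by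
  simp [mulVec, dotProduct]

theorem im_map_ofReal_mulVec {ι κ : Type*} [Fintype κ] (M : Matrix ι κ ℝ) (v : κ → ℂ) (i : ι) :
    ((M.map Complex.ofReal *ᵥ v) i).im = (M *ᵥ fun j => (v j).im) i := by
  simp [mulVec, dotProduct]

/-- The squared Euclidean norm splits along a Hermitian idempotent. -/
theorem sum_norm_sq_eq_add_of_isHermitian [DecidableEq ι] {P : Matrix ι ι ℂ} (hP : P.IsHermitian)
    (hPP : P * P = P) (v : ι → ℂ) :
    ∑ i, ‖v i‖ ^ 2 = ∑ i, ‖(P *ᵥ v) i‖ ^ 2 + ∑ i, ‖(v - P *ᵥ v) i‖ ^ 2 := by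
  have key : ∀ w : ι → ℂ, ((∑ i, ‖w i‖ ^ 2 : ℝ) : ℂ) = star w ⬝ᵥ w := by
    intro w
    simp [dotProduct, Complex.conj_mul']
  have hst : star (P *ᵥ v) = star v ᵥ* P := by rw [star_mulVec, hP.eq]
  apply Complex.ofReal_injective
  rw [Complex.ofReal_add, key, key, key, star_sub, sub_dotProduct, dotProduct_sub, dotProduct_sub,
    hst]
  have h1 : (star v ᵥ* P) ⬝ᵥ (P *ᵥ v) = star v ⬝ᵥ (P *ᵥ v) := by
    rw [← dotProduct_mulVec, mulVec_mulVec, hPP]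
  have h2 : (star v ᵥ* P) ⬝ᵥ v = star v ⬝ᵥ (P *ᵥ v) := by
    rw [← dotProduct_mulVec]
  rw [h1, h2]
  ring

/-- If the range of the orthogonal projector `P` is invariant under `R` and `R` is contractive on
the kernel of `P` without nonzero eigenvalues there, then all eigenvectors of `R` for eigenvalues
outside the open unit disc lie in the range of `P`. -/
theorem mulVec_eq_self_of_one_le_norm [DecidableEq ι] {P R : Matrix ι ι ℂ} (hP : P.IsHermitian)
    (hPP : P * P = P) (hinv : P * (R * P) = R * P)
    (hcontr : ∀ w, P *ᵥ w = 0 → ∑ i, ‖(R *ᵥ w) i‖ ^ 2 ≤ ∑ i, ‖w i‖ ^ 2)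
    (hker : ∀ (w : ι → ℂ) (z : ℂ), P *ᵥ w = 0 → z ≠ 0 → R *ᵥ w = z • w → w = 0)
    {v : ι → ℂ} {z : ℂ} (hz : 1 ≤ ‖z‖) (hv : R *ᵥ v = z • v) : P *ᵥ v = v := by
  set w := v - P *ᵥ v with hw
  have hPw : P *ᵥ w = 0 := by rw [hw, mulVec_sub, mulVec_mulVec, hPP, sub_self]
  -- Modulo the invariant range of `P`, the vector `w` is still an eigenvector. Pythagoras for `R *ᵥ
  -- w`, with `1 ≤ ‖z‖` and contractivity, then leaves no room for the component `P *ᵥ (R *ᵥ w)`.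
  have hRw : R *ᵥ w - P *ᵥ (R *ᵥ w) = z • w := by
    have h1 : R *ᵥ w = z • v - (R * P) *ᵥ v := by
      rw [hw, mulVec_sub, hv, mulVec_mulVec]
    rw [h1, mulVec_sub, mulVec_mulVec, hinv, mulVec_smul, hw, smul_sub]
    abel
  have hsplit := sum_norm_sq_eq_add_of_isHermitian hP hPP (R *ᵥ w)
  rw [hRw] at hsplit
  have hle := hcontr w hPw
  have hzw : ∑ i, ‖w i‖ ^ 2 ≤ ∑ i, ‖(z • w) i‖ ^ 2 := by
    apply Finset.sum_le_sum
    intro i _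
    rw [Pi.smul_apply, smul_eq_mul, norm_mul]
    gcongr
    nlinarith [norm_nonneg (w i)]
  have h0 : ∑ i, ‖(P *ᵥ (R *ᵥ w)) i‖ ^ 2 = 0 :=
    le_antisymm (by linarith) (Finset.sum_nonneg fun _ _ => by positivity)
  have hPR : P *ᵥ (R *ᵥ w) = 0 := by
    ext i
    have := (Finset.sum_eq_zero_iff_of_nonneg fun _ _ => by positivity).mp h0 i (Finset.mem_univ i)
    simpa using this
  have hw0 : w = 0 := by
    apply hker w z hPw
    · rintro rfl
      norm_num at hz
    · rw [← hRw, hPR, sub_zero]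
  exact (sub_eq_zero.mp hw0).symm

end LinearAlgebra

namespace LTISystem

variable {n m p : ℕ} (S : LTISystem n m p)

/-! ### Trajectories with vanishing output -/

/-- The signals `x`, `u` satisfy the system equations with zero output at the times
`0, …, t - 1`. -/
structure IsNullTrajectory (t : ℕ) (x : ℕ → Fin n → ℝ) (u : ℕ → Fin m → ℝ) : Prop where
  state : ∀ k, k + 1 < t → x (k + 1) = S.A *ᵥ x k + S.B *ᵥ u k
  output : ∀ k, k < t → S.C *ᵥ x k + S.D *ᵥ u k = 0

namespace IsNullTrajectory

variable {S} {t : ℕ} {x x' : ℕ → Fin n → ℝ} {u u' : ℕ → Fin m → ℝ}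

theorem mono (h : S.IsNullTrajectory t x u) {s : ℕ} (hs : s ≤ t) : S.IsNullTrajectory s x u :=
  ⟨fun k hk => h.state k (by omega), fun k hk => h.output k (by omega)⟩

theorem zero : S.IsNullTrajectory t 0 0 :=
  ⟨fun k _ => by simp, fun k _ => by simp⟩

theorem add (h : S.IsNullTrajectory t x u) (h' : S.IsNullTrajectory t x' u') :
    S.IsNullTrajectory t (x + x') (u + u') := by
  refine ⟨fun k hk => ?_, fun k hk => ?_⟩
  · simp only [Pi.add_apply, h.state k hk, h'.state k hk, mulVec_add]
    abel
  · have h1 := h.output k hk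
    have h2 := h'.output k hk
    simp only [Pi.add_apply, mulVec_add]
    rw [add_add_add_comm, h1, h2, add_zero]

theorem smul (c : ℝ) (h : S.IsNullTrajectory t x u) : S.IsNullTrajectory t (c • x) (c • u) := by
  refine ⟨fun k hk => ?_, fun k hk => ?_⟩
  · simp only [Pi.smul_apply, h.state k hk, mulVec_smul, smul_add]
  · simp only [Pi.smul_apply, mulVec_smul]
    rw [← smul_add, h.output k hk, smul_zero]

theorem sub (h : S.IsNullTrajectory t x u) (h' : S.IsNullTrajectory t x' u') :
    S.IsNullTrajectory t (x - x') (u - u') := by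
  simpa [sub_eq_add_neg] using h.add (h'.smul (-1))

theorem shift {s : ℕ} (h : S.IsNullTrajectory (t + s) x u) :
    S.IsNullTrajectory t (fun k => x (k + s)) (fun k => u (k + s)) :=
  ⟨fun k hk => by
    have := h.state (k + s) (by omega)
    rwa [show k + s + 1 = k + 1 + s by omega] at this,
   fun k hk => h.output (k + s) (by omega)⟩

theorem cons (h : S.IsNullTrajectory t x u) {x₀ : Fin n → ℝ} {u₀ : Fin m → ℝ}
    (hx : x 0 = S.A *ᵥ x₀ + S.B *ᵥ u₀) (hy : S.C *ᵥ x₀ + S.D *ᵥ u₀ = 0) :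
    S.IsNullTrajectory (t + 1) (fun k => k.casesOn x₀ x) (fun k => k.casesOn u₀ u) := by
  refine ⟨fun k hk => ?_, fun k hk => ?_⟩
  · cases k with
    | zero => exact hx
    | succ k => exact h.state k (by omega)
  · cases k with
    | zero => exact hy
    | succ k => exact h.output k (by omega)

/-- With zero input the first `n` outputs are the observability matrix applied to `x 0`. -/
theorem initial_eq_zero (hobs : S.IsObservable) (h : S.IsNullTrajectory t x u) (ht : n ≤ t)
    (hu : ∀ k, k < n → u k = 0) : x 0 = 0 := by
  have hx : ∀ k, k < n → x k = (S.A ^ k) *ᵥ x 0 := by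
    intro k
    induction k with
    | zero => simp
    | succ k ih =>
      intro hk
      rw [h.state k (by omega), ih (by omega), hu k (by omega), mulVec_zero, add_zero, mulVec_mulVec,
        pow_succ']
  apply eq_zero_of_mulVec_eq_zero (M := S.observabilityMatrix) (by rw [hobs, Fintype.card_fin])
  ext ⟨k, a⟩
  have h1 := h.output k (by omega)
  rw [hx k k.2, hu k k.2, mulVec_zero, add_zero, mulVec_mulVec] at h1
  exact congrFun h1 a

theorem input_zero_eq_zero {L₀ : ℕ} (hinv : S.IsDelayInvertible L₀)
    (h : S.IsNullTrajectory t x u) (ht : L₀ < t) (hx : x 0 = 0) : u 0 = 0 := by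
  refine hinv (fun k => x k) 0 (fun k => u k) 0 0 ⟨fun k hk => h.state k (by omega), fun k => ?_⟩
    ⟨fun k hk => by simp, fun k => by simp⟩ (by simpa using hx)
  exact (h.output k (by omega)).symm

/-- A zero state forces a zero input by comparison with the zero trajectory, and hence a zero next
state. Each comparison looks `L₀` steps ahead, so the last `L₀` samples are not reached. -/
theorem eq_zero_of_initial {L₀ : ℕ} (hinv : S.IsDelayInvertible L₀)
    (h : S.IsNullTrajectory t x u) (hx : x 0 = 0) (k : ℕ) (hk : k + L₀ < t) :
    x k = 0 ∧ u k = 0 := by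
  have hu : ∀ k, k + L₀ < t → x k = 0 → u k = 0 := by
    intro k hk hxk
    have h' : S.IsNullTrajectory ((t - k) + k) x u := h.mono (by omega)
    simpa using h'.shift.input_zero_eq_zero hinv (by omega) (by simpa using hxk)
  have hx' : x k = 0 := by
    induction k with
    | zero => exact hx
    | succ k ih =>
      have ih := ih (by omega)
      rw [h.state k (by omega), ih, hu k (by omega) ih]
      simp
  exact ⟨hx', hu k hk hx'⟩

end IsNullTrajectory

/-- The initial states from which zero output can be maintained for `t` steps. -/
def nullStates (t : ℕ) : Submodule ℝ (Fin n → ℝ) where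
  carrier := {a | ∃ x u, S.IsNullTrajectory t x u ∧ x 0 = a}
  zero_mem' := ⟨0, 0, .zero, rfl⟩
  add_mem' := by
    rintro _ _ ⟨x, u, h, rfl⟩ ⟨x', u', h', rfl⟩
    exact ⟨_, _, h.add h', rfl⟩
  smul_mem' := by
    rintro c _ ⟨x, u, h, rfl⟩
    exact ⟨_, _, h.smul c, rfl⟩

theorem nullStates_succ_le (t : ℕ) : S.nullStates (t + 1) ≤ S.nullStates t := by
  rintro _ ⟨x, u, h, rfl⟩
  exact ⟨x, u, h.mono (by omega), rfl⟩

/-- This recursion makes each space a function of the preceding one, so a chain that stalls once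
stalls for ever. -/
theorem mem_nullStates_succ {t : ℕ} {a : Fin n → ℝ} :
    a ∈ S.nullStates (t + 1) ↔
      ∃ b, S.C *ᵥ a + S.D *ᵥ b = 0 ∧ S.A *ᵥ a + S.B *ᵥ b ∈ S.nullStates t := by
  constructor
  · rintro ⟨x, u, h, rfl⟩
    refine ⟨u 0, h.output 0 (by omega), ?_⟩
    rcases Nat.eq_zero_or_pos t with rfl | ht
    · exact ⟨fun _ => _, 0, ⟨fun k hk => by omega, fun k hk => by omega⟩, rfl⟩
    · exact ⟨_, _, h.shift, h.state 0 (by omega)⟩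
  · rintro ⟨b, hb, x, u, h, hx⟩
    exact ⟨_, _, h.cons hx hb, rfl⟩

theorem nullStates_stable_succ {t : ℕ} (h : S.nullStates (t + 1) = S.nullStates t) :
    S.nullStates (t + 1 + 1) = S.nullStates (t + 1) := by
  ext a
  rw [mem_nullStates_succ, mem_nullStates_succ, h]

/-- The spaces decrease inside an `n`-dimensional space, and each strict inclusion costs a
dimension. -/
theorem nullStates_succ_eq_of_le {t : ℕ} (ht : n ≤ t) :
    S.nullStates (t + 1) = S.nullStates t := by
  have key : ∀ k, Module.finrank ℝ (S.nullStates k) + k ≤ n ∨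
      S.nullStates (k + 1) = S.nullStates k := by
    intro k
    induction k with
    | zero => exact Or.inl (by simpa using (S.nullStates 0).finrank_le)
    | succ k ih =>
      by_cases heq : S.nullStates (k + 1) = S.nullStates k
      · exact Or.inr (S.nullStates_stable_succ heq)
      · have := Submodule.finrank_lt_finrank_of_lt (lt_of_le_of_ne (S.nullStates_succ_le k) heq)
        have := ih.resolve_right heq
        exact Or.inl (by omega)
  induction t, ht using Nat.le_induction with
  | base =>
    rcases key n with h | h
    · have h0 : S.nullStates n = ⊥ := Submodule.finrank_eq_zero.mp (by omega)
      have := S.nullStates_succ_le n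
      rw [h0] at this ⊢
      exact le_bot_iff.mp this
    · exact h
  | succ k _ ih => exact S.nullStates_stable_succ ih

theorem IsNullTrajectory.exists_extension {S : LTISystem n m p} {t : ℕ} {x : ℕ → Fin n → ℝ}
    {u : ℕ → Fin m → ℝ} (h : S.IsNullTrajectory t x u) (ht : n ≤ t) :
    ∃ x' u', S.IsNullTrajectory (t + 1) x' u' ∧ x' 0 = x 0 := by
  have : x 0 ∈ S.nullStates (t + 1) := by
    rw [S.nullStates_succ_eq_of_le ht]
    exact ⟨x, u, h, rfl⟩
  exact this

end LTISystem

/-! ### Persistency of excitation and the fundamental lemma -/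

/-- A linear relation between the states and windows of `M` inputs along a trajectory is trivial
if the input satisfies no nontrivial linear relation on windows of `n + M` samples. -/
theorem eq_zero_of_annihilates_trajectory {n m ℓ M : ℕ} {A : Matrix (Fin n) (Fin n) ℝ}
    {B : Matrix (Fin n) (Fin m) ℝ} {x : ℕ → Fin n → ℝ} {u : ℕ → Fin m → ℝ} (hM : 0 < M)
    (hx : ∀ k, k + 1 < ℓ → x (k + 1) = A *ᵥ x k + B *ᵥ u k)
    (hu : ∀ ζ : ℕ → Fin m → ℝ, (∀ j, j + (n + M) ≤ ℓ →
      ∑ q ∈ Finset.range (n + M), ζ q ⬝ᵥ u (j + q) = 0) → ∀ q < n + M, ζ q = 0)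
    {ξ : Fin n → ℝ} {η : ℕ → Fin m → ℝ}
    (h : ∀ j, j + M ≤ ℓ → ξ ⬝ᵥ x j + ∑ i ∈ Finset.range M, η i ⬝ᵥ u (j + i) = 0) :
    (∀ i < M, η i = 0) ∧ ∀ k < n, ξ ᵥ* (A ^ k * B) = 0 := by
  set e : ℕ → Fin m → ℝ := fun l => if l < M then η (M - 1 - l) else ξ ᵥ* (A ^ (l - M) * B)
    with he
  have hstep : ∀ k j, j + k + M ≤ ℓ →
      ξ ᵥ* A ^ k ⬝ᵥ x j + ∑ q ∈ Finset.range (k + M), e (k + M - 1 - q) ⬝ᵥ u (j + q) = 0 := by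
    intro k
    induction k with
    | zero =>
      intro j hj
      rw [pow_zero, vecMul_one, ← h j (by omega), zero_add]
      congr 1
      apply Finset.sum_congr rfl
      intro q hq
      have hq := Finset.mem_range.mp hq
      rw [he]
      dsimp only
      rw [if_pos (by omega), show M - 1 - (M - 1 - q) = q by omega]
    | succ k ih =>
      intro j hj
      rw [← ih (j + 1) (by omega), show k + 1 + M = (k + M) + 1 by omega, Finset.sum_range_succ',
        hx j (by omega)]
      have h1 : e (k + M + 1 - 1 - 0) = ξ ᵥ* (A ^ k * B) := by
        rw [he]
        dsimp only
        rw [if_neg (by omega), show k + M + 1 - 1 - 0 - M = k by omega]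
      have h2 : ∀ q, e (k + M + 1 - 1 - (q + 1)) ⬝ᵥ u (j + (q + 1))
          = e (k + M - 1 - q) ⬝ᵥ u (j + 1 + q) := by
        intro q
        rw [show k + M + 1 - 1 - (q + 1) = k + M - 1 - q by omega,
          show j + (q + 1) = j + 1 + q by omega]
      simp only [h1, h2, dotProduct_add, add_zero]
      rw [dotProduct_mulVec, dotProduct_mulVec, vecMul_vecMul, vecMul_vecMul, ← pow_succ]
      ring
  set c : ℕ → ℝ := fun k => A.charpoly.coeff k
  have hdeg : A.charpoly.natDegree = n := by
    rw [charpoly_natDegree_eq_dim, Fintype.card_fin]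
  have hcn : c n = 1 := by
    have := A.charpoly_monic.coeff_natDegree
    rwa [hdeg] at this
  have hCH : ∑ k ∈ Finset.range (n + 1), c k • A ^ k = 0 := by
    rw [← A.aeval_self_charpoly, Polynomial.aeval_eq_sum_range, hdeg]
  -- Combining the shifted relations with the coefficients of the characteristic polynomial removes
  -- the state by Cayley-Hamilton. What remains is a relation on windows of `n + M` inputs.
  have hz := hu (fun q => ∑ k ∈ Finset.range (n + 1),
    if q < k + M then c k • e (k + M - 1 - q) else 0) (by
      intro j hj
      have h1 : ∑ k ∈ Finset.range (n + 1), c k * (ξ ᵥ* A ^ k ⬝ᵥ x j) = 0 := by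
        have : ∀ k, c k * (ξ ᵥ* A ^ k ⬝ᵥ x j) = ξ ⬝ᵥ ((c k • A ^ k) *ᵥ x j) := by
          intro k
          rw [smul_mulVec, dotProduct_smul, dotProduct_mulVec, smul_eq_mul]
        simp only [this]
        rw [← dotProduct_sum, ← sum_mulVec, hCH, zero_mulVec, dotProduct_zero]
      simp only [sum_dotProduct]
      rw [Finset.sum_comm]
      refine (add_zero _).symm.trans ((congrArg _ h1.symm).trans ?_)
      rw [← Finset.sum_add_distrib]
      apply Finset.sum_eq_zero
      intro k hk
      have hk := Finset.mem_range.mp hk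
      have h2 : ∑ q ∈ Finset.range (n + M),
          (if q < k + M then c k • e (k + M - 1 - q) else 0) ⬝ᵥ u (j + q) =
          c k * ∑ q ∈ Finset.range (k + M), e (k + M - 1 - q) ⬝ᵥ u (j + q) := by
        rw [Finset.mul_sum]
        refine (Finset.sum_subset (s₁ := Finset.range (k + M))
          (Finset.range_subset_range.mpr (by omega)) ?_).symm.trans ?_
        rotate_left
        · apply Finset.sum_congr rfl
          intro q hq
          rw [if_pos (Finset.mem_range.mp hq), smul_dotProduct, smul_eq_mul]
        · intro q _ hq
          rw [if_neg (fun h => hq (Finset.mem_range.mpr h)), zero_dotProduct]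
      rw [h2, ← mul_add, add_comm, hstep k j (by omega), mul_zero])
  -- The system is triangular in `e`: the term `k = n` has coefficient one, and the others involve
  -- only smaller indices.
  have he0 : ∀ l, l < n + M → e l = 0 := by
    intro l
    induction l using Nat.strong_induction_on with
    | _ l ih =>
      intro hl
      have h1 := hz (n + M - 1 - l) (by omega)
      rw [Finset.sum_range_succ, if_pos (by omega), hcn, one_smul,
        show n + M - 1 - (n + M - 1 - l) = l by omega, Finset.sum_eq_zero, zero_add] at h1
      · exact h1
      · intro k hk
        have hk := Finset.mem_range.mp hk
        split_ifs with hlt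
        · rw [ih _ (by omega) (by omega), smul_zero]
        · rfl
  constructor
  · intro i hi
    have h1 := he0 (M - 1 - i) (by omega)
    rw [he] at h1
    dsimp only at h1
    rwa [if_pos (by omega), show M - 1 - (M - 1 - i) = i by omega] at h1
  · intro k hk
    have h1 := he0 (k + M) (by omega)
    rw [he] at h1
    dsimp only at h1
    rwa [if_neg (by omega), show k + M - M = k by omega] at h1

/-- The extension of a finite signal by zero. -/
def extendZero {ℓ d : ℕ} (w : Fin ℓ → Fin d → ℝ) (k : ℕ) : Fin d → ℝ :=
  if h : k < ℓ then w ⟨k, h⟩ else 0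

theorem extendZero_of_lt {ℓ d : ℕ} (w : Fin ℓ → Fin d → ℝ) {k : ℕ} (h : k < ℓ) :
    extendZero w k = w ⟨k, h⟩ := dif_pos h

theorem PersistentlyExciting.eq_zero {ℓ d t : ℕ} {w : Fin ℓ → Fin d → ℝ}
    (h : PersistentlyExciting t w) {ζ : ℕ → Fin d → ℝ}
    (hζ : ∀ j, j + t ≤ ℓ → ∑ q ∈ Finset.range t, ζ q ⬝ᵥ extendZero w (j + q) = 0) :
    ∀ q < t, ζ q = 0 := by
  have hv : (fun r : Fin t × Fin d => ζ r.1 r.2) = 0 := by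
    apply eq_zero_of_vecMul_eq_zero (M := hankel t w) (by
      rw [Fintype.card_prod, Fintype.card_fin, Fintype.card_fin]; exact h)
    ext j
    rw [Pi.zero_apply, ← hζ j (by omega), Finset.sum_range, vecMul, dotProduct,
      Fintype.sum_prod_type]
    apply Finset.sum_congr rfl
    intro q _
    rw [extendZero_of_lt _ (by omega)]
    apply Finset.sum_congr rfl
    intro b _
    simp only [hankel, add_comm]
  intro q hq
  ext b
  exact congrFun hv (⟨q, hq⟩, b)

theorem hankel_apply {ℓ d t : ℕ} (w : Fin ℓ → Fin d → ℝ) (i : Fin t) (a : Fin d)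
    (j : Fin (ℓ + 1 - t)) : hankel t w (i, a) j = w ⟨j + i, by omega⟩ a := by
  simp only [hankel, add_comm]

/-- Willems' fundamental lemma: initial states and input windows of length `W + 1` can be
prescribed arbitrarily in the column span of the data. -/
theorem exists_hankel_mulVec_eq {n m p ℓ W : ℕ} {S : LTISystem n m p} (hctr : S.IsControllable)
    {xd : Fin ℓ → Fin n → ℝ} {ud : Fin ℓ → Fin m → ℝ} {yd : Fin ℓ → Fin p → ℝ}
    (htraj : S.IsTrajectory xd ud yd) (hPE : PersistentlyExciting (n + (W + 1)) ud)
    (x₀ : Fin n → ℝ) (u : Fin (W + 1) × Fin m → ℝ) :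
    ∃ g, (∀ a, (hankel (W + 1) xd *ᵥ g) (0, a) = x₀ a) ∧ hankel (W + 1) ud *ᵥ g = u := by
  obtain ⟨g, hg⟩ := mulVec_surjective_of_vecMul
    -- Surjectivity amounts to a trivial left kernel of the stacked data. Excitation kills the input
    -- coefficients, and controllability the state coefficients.
    (M := fromRows ((hankel (W + 1) xd).submatrix (fun a => (0, a)) id) (hankel (W + 1) ud)) (by
      intro v hv
      obtain ⟨hη, hξ⟩ := eq_zero_of_annihilates_trajectory (x := extendZero xd)
        (u := extendZero ud) (A := S.A) (B := S.B) (ℓ := ℓ) (M := W + 1)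
        (ξ := fun a => v (.inl a))
        (η := fun i b => if h : i < W + 1 then v (.inr (⟨i, h⟩, b)) else 0) (by omega)
        (fun k hk => by
          rw [extendZero_of_lt _ hk, extendZero_of_lt _ (by omega), extendZero_of_lt _ (by omega)]
          exact htraj.1 k hk)
        (fun ζ hζ => hPE.eq_zero hζ)
        (fun j hj => by
          have h1 := congrFun hv ⟨j, by omega⟩
          rw [Pi.zero_apply, vecMul, dotProduct, Fintype.sum_sum_type, Fintype.sum_prod_type] at h1
          refine Eq.trans ?_ h1
          rw [Finset.sum_range]
          simp only [submatrix_apply, id_eq, fromRows_apply_inl, fromRows_apply_inr, hankel_apply]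
          congr 1
          · rw [extendZero_of_lt _ (by omega)]
            rfl
          · apply Finset.sum_congr rfl
            intro i _
            rw [extendZero_of_lt _ (by omega)]
            apply Finset.sum_congr rfl
            intro b _
            simp only [i.2, dif_pos])
      have hξ0 : (fun a => v (.inl a)) = 0 := by
        apply eq_zero_of_vecMul_eq_zero (M := S.controllabilityMatrix)
          (by rw [hctr, Fintype.card_fin])
        ext ⟨k, b⟩
        exact congrFun (hξ k k.2) b
      ext r
      rcases r with a | ⟨i, b⟩
      · exact congrFun hξ0 a
      · have h1 := congrFun (hη i i.2) b
        simp only [i.2, dif_pos] at h1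
        exact h1) (Sum.elim x₀ u)
  rw [fromRows_mulVec] at hg
  refine ⟨g, fun a => ?_, ?_⟩
  · exact congrFun hg (.inl a)
  · ext r
    exact congrFun hg (.inr r)

/-! ### Signals in the column span of the data -/

/-- The signal of length `t` whose samples are the block entries of `hankel t w *ᵥ g`. -/
def hankelSignal {ℓ d : ℕ} (t : ℕ) (w : Fin ℓ → Fin d → ℝ) (g : Fin (ℓ + 1 - t) → ℝ) (k : ℕ) :
    Fin d → ℝ :=
  fun a => if h : k < t then (hankel t w *ᵥ g) (⟨k, h⟩, a) else 0

theorem hankelSignal_of_lt {ℓ d t : ℕ} (w : Fin ℓ → Fin d → ℝ) (g : Fin (ℓ + 1 - t) → ℝ) {k : ℕ}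
    (h : k < t) : hankelSignal t w g k = ∑ j : Fin (ℓ + 1 - t), g j • w ⟨k + j, by omega⟩ := by
  ext a
  simp [hankelSignal, h, mulVec, dotProduct, hankel, mul_comm]

namespace LTISystem.IsTrajectory

variable {n m p ℓ t : ℕ} {S : LTISystem n m p} {xd : Fin ℓ → Fin n → ℝ} {ud : Fin ℓ → Fin m → ℝ}
  {yd : Fin ℓ → Fin p → ℝ}

theorem hankelSignal_succ (htraj : S.IsTrajectory xd ud yd) (g : Fin (ℓ + 1 - t) → ℝ) {k : ℕ}
    (hk : k + 1 < t) : hankelSignal t xd g (k + 1) =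
      S.A *ᵥ hankelSignal t xd g k + S.B *ᵥ hankelSignal t ud g k := by
  rw [hankelSignal_of_lt _ _ hk, hankelSignal_of_lt _ _ (by omega),
    hankelSignal_of_lt _ _ (by omega), mulVec_sum, mulVec_sum, ← Finset.sum_add_distrib]
  apply Finset.sum_congr rfl
  intro j _
  rw [mulVec_smul, mulVec_smul, ← smul_add, ← htraj.1 (k + j) (by omega)]
  congr 3
  omega

theorem hankelSignal_output (htraj : S.IsTrajectory xd ud yd) (g : Fin (ℓ + 1 - t) → ℝ) {k : ℕ}
    (hk : k < t) : hankelSignal t yd g k =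
      S.C *ᵥ hankelSignal t xd g k + S.D *ᵥ hankelSignal t ud g k := by
  rw [hankelSignal_of_lt _ _ hk, hankelSignal_of_lt _ _ hk, hankelSignal_of_lt _ _ hk,
    mulVec_sum, mulVec_sum, ← Finset.sum_add_distrib]
  apply Finset.sum_congr rfl
  intro j _
  rw [mulVec_smul, mulVec_smul, ← smul_add, ← htraj.2]

theorem isNullTrajectory_hankelSignal (htraj : S.IsTrajectory xd ud yd)
    {g : Fin (ℓ + 1 - t) → ℝ} (hg : hankel t yd *ᵥ g = 0) :
    S.IsNullTrajectory t (hankelSignal t xd g) (hankelSignal t ud g) := by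
  refine ⟨fun k hk => htraj.hankelSignal_succ g hk, fun k hk => ?_⟩
  rw [← htraj.hankelSignal_output g hk]
  ext a
  simp [hankelSignal, hg]

/-- Under persistency of excitation every zero-output trajectory lies in the column span of the
data. -/
theorem exists_hankelSignal_eq {W : ℕ} (htraj : S.IsTrajectory xd ud yd) (hctr : S.IsControllable)
    (hPE : PersistentlyExciting (n + (W + 1)) ud) {x : ℕ → Fin n → ℝ} {u : ℕ → Fin m → ℝ}
    (h : S.IsNullTrajectory (W + 1) x u) :
    ∃ g, hankel (W + 1) yd *ᵥ g = 0 ∧ ∀ k < W + 1, hankelSignal (W + 1) ud g k = u k := by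
  obtain ⟨g, hx, hu⟩ := exists_hankel_mulVec_eq hctr htraj hPE (x 0) fun r => u r.1 r.2
  have hu' : ∀ k < W + 1, hankelSignal (W + 1) ud g k = u k := by
    intro k hk
    ext a
    simp only [hankelSignal, hk, dif_pos, hu]
  have hx' : ∀ k < W + 1, hankelSignal (W + 1) xd g k = x k := by
    intro k
    induction k with
    | zero =>
      intro hk
      ext a
      simp only [hankelSignal, hk, dif_pos, ← hx]
      rfl
    | succ k ih =>
      intro hk
      rw [htraj.hankelSignal_succ g hk, ih (by omega), hu' k (by omega), h.state k hk]
  refine ⟨g, ?_, hu'⟩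
  ext ⟨k, a⟩
  have h1 := htraj.hankelSignal_output g k.2
  rw [hx' k k.2, hu' k k.2, h.output k k.2] at h1
  have h2 := congrFun h1 a
  simp only [hankelSignal, k.2, dif_pos] at h2
  exact h2

end LTISystem.IsTrajectory

/-! ### Projectors and block companion matrices -/

theorem mul_kerProj {ι κ : Type*} [Fintype ι] [Fintype κ] [DecidableEq κ] (M : Matrix ι κ ℝ) :
    M * kerProj M = 0 := by
  rw [kerProj, Matrix.mul_sub, Matrix.mul_one, ← Matrix.mul_assoc, (pinv_spec M).mul_mul_self,
    sub_self]

theorem kerProj_mulVec {ι κ : Type*} [Fintype ι] [Fintype κ] [DecidableEq κ] {M : Matrix ι κ ℝ}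
    {g : κ → ℝ} (hg : M *ᵥ g = 0) : kerProj M *ᵥ g = g := by
  rw [kerProj, sub_mulVec, one_mulVec, ← mulVec_mulVec, hg, mulVec_zero, sub_zero]

/-- The ring homomorphism lets the formula serve both over `ℝ` and over `ℂ`. -/
theorem map_blockCompanion_mulVec {K : Type*} [CommRing K] (f : ℝ →+* K) {N m : ℕ}
    (G : Matrix (Fin m) (Fin N × Fin m) ℝ) (v : Fin N × Fin m → K) (i : Fin N) (a : Fin m) :
    ((blockCompanion G).map f *ᵥ v) (i, a) =
      if h : (i : ℕ) + 1 < N then v (⟨i + 1, h⟩, a) else (G.map f *ᵥ v) a := by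
  split_ifs with h
  · rw [mulVec, dotProduct, Finset.sum_eq_single (⟨i + 1, h⟩, a)]
    · simp [blockCompanion, h]
    · rintro ⟨j, b⟩ - hne
      have : ¬ ((j : ℕ) = i + 1 ∧ b = a) := by
        rintro ⟨h1, rfl⟩
        exact hne (by rw [Prod.mk.injEq]; exact ⟨Fin.ext h1, rfl⟩)
      simp [blockCompanion, h, this]
    · simp
  · simp [mulVec, dotProduct, blockCompanion, h]

/-- The shift drops the first block and appends a zero block. -/
theorem sum_norm_sq_map_blockCompanion_mulVec_le {N m : ℕ} {G : Matrix (Fin m) (Fin N × Fin m) ℝ}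
    {w : Fin N × Fin m → ℂ} (hw : G.map Complex.ofRealHom *ᵥ w = 0) :
    ∑ r, ‖((blockCompanion G).map Complex.ofRealHom *ᵥ w) r‖ ^ 2 ≤ ∑ r, ‖w r‖ ^ 2 := by
  rw [Fintype.sum_prod_type, Fintype.sum_prod_type]
  simp only [map_blockCompanion_mulVec, hw]
  cases N with
  | zero => simp
  | succ N =>
    rw [Fin.sum_univ_castSucc, Fin.sum_univ_succ (n := N)]
    have h1 : ∀ i : Fin N, ∑ a, ‖if h : (i.castSucc : ℕ) + 1 < N + 1 then
        w (⟨i.castSucc + 1, h⟩, a) else (0 : Fin m → ℂ) a‖ ^ 2 = ∑ a, ‖w (i.succ, a)‖ ^ 2 := by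
      intro i
      apply Finset.sum_congr rfl
      intro a _
      rw [dif_pos (by simp)]
      rfl
    simp only [h1]
    simp only [Fin.val_last, lt_irrefl, dif_neg, not_false_eq_true, Pi.zero_apply, norm_zero,
      ne_eq, OfNat.ofNat_ne_zero, zero_pow, Finset.sum_const_zero, add_zero]
    have : 0 ≤ ∑ a, ‖w (0, a)‖ ^ 2 := Finset.sum_nonneg fun _ _ => by positivity
    linarith

/-- The last block vanishes because `z ≠ 0`; the others follow by going backwards, by induction on
the distance from the last block. -/
theorem eq_zero_of_map_blockCompanion_mulVec_eq_smul {N m : ℕ}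
    {G : Matrix (Fin m) (Fin N × Fin m) ℝ} {w : Fin N × Fin m → ℂ} {z : ℂ}
    (hw : G.map Complex.ofRealHom *ᵥ w = 0) (hz : z ≠ 0)
    (h : (blockCompanion G).map Complex.ofRealHom *ᵥ w = z • w) : w = 0 := by
  have key : ∀ k (i : Fin N) (a : Fin m), N - 1 - i = k → w (i, a) = 0 := by
    intro k
    induction k with
    | zero =>
      intro i a hi
      have h1 := congrFun h (i, a)
      rw [map_blockCompanion_mulVec, dif_neg (by omega), hw] at h1
      simpa [hz] using h1.symm
    | succ k ih =>
      intro i a hi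
      have h1 := congrFun h (i, a)
      rw [map_blockCompanion_mulVec, dif_pos (by omega), ih _ _ (by simp only; omega)] at h1
      simpa [hz] using h1.symm
  ext ⟨i, a⟩
  exact key _ i a rfl

/-! ### Invariant zeros -/

namespace LTISystem

variable {n m p : ℕ} {S : LTISystem n m p}

theorem isInvariantZero_iff {z : ℂ} : S.IsInvariantZero z ↔
    ∃ (x : Fin n → ℂ) (u : Fin m → ℂ), ¬ (x = 0 ∧ u = 0) ∧
      S.A.map Complex.ofReal *ᵥ x + S.B.map Complex.ofReal *ᵥ u = z • x ∧
      S.C.map Complex.ofReal *ᵥ x + S.D.map Complex.ofReal *ᵥ u = 0 := by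
  have key : ∀ (x : Fin n → ℂ) (u : Fin m → ℂ), S.systemMatrix z *ᵥ Sum.elim x u = 0 ↔
      S.A.map Complex.ofReal *ᵥ x + S.B.map Complex.ofReal *ᵥ u = z • x ∧
      S.C.map Complex.ofReal *ᵥ x + S.D.map Complex.ofReal *ᵥ u = 0 := by
    intro x u
    rw [systemMatrix, fromBlocks_mulVec, Sum.elim_comp_inl, Sum.elim_comp_inr, ← Sum.elim_zero_zero,
      Sum.elim_eq_iff, sub_mulVec, smul_mulVec, one_mulVec, sub_add_eq_add_sub, sub_eq_zero]
  have hcard : n + m = Fintype.card (Fin n ⊕ Fin m) := by simp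
  rw [IsInvariantZero, hcard, rank_lt_card_iff_exists_mulVec_eq_zero]
  constructor
  · rintro ⟨v, hne, hv⟩
    refine ⟨v ∘ Sum.inl, v ∘ Sum.inr, fun h => hne ?_, (key _ _).mp ?_⟩
    · rw [← Sum.elim_comp_inl_inr v, h.1, h.2, Sum.elim_zero_zero]
    · rwa [Sum.elim_comp_inl_inr]
  · rintro ⟨x, u, hne, h⟩
    refine ⟨Sum.elim x u, fun h0 => hne ?_, (key x u).mpr h⟩
    rwa [← Sum.elim_zero_zero, Sum.elim_eq_iff] at h0

/-- The geometric progression generated by a kernel vector of the system matrix has vanishing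
output. -/
theorem isNullTrajectory_pow {z : ℂ} {x : Fin n → ℂ} {u : Fin m → ℂ}
    (h1 : S.A.map Complex.ofReal *ᵥ x + S.B.map Complex.ofReal *ᵥ u = z • x)
    (h2 : S.C.map Complex.ofReal *ᵥ x + S.D.map Complex.ofReal *ᵥ u = 0) (t : ℕ) :
    S.IsNullTrajectory t (fun k a => (z ^ k * x a).re) (fun k a => (z ^ k * u a).re) ∧
      S.IsNullTrajectory t (fun k a => (z ^ k * x a).im) (fun k a => (z ^ k * u a).im) := by
  have h1' : ∀ k, S.A.map Complex.ofReal *ᵥ (fun a => z ^ k * x a) +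
      S.B.map Complex.ofReal *ᵥ (fun a => z ^ k * u a) = fun a => z ^ (k + 1) * x a := by
    intro k
    have hx : (fun a => z ^ k * x a) = z ^ k • x := rfl
    have hu : (fun a => z ^ k * u a) = z ^ k • u := rfl
    have hx' : (fun a => z ^ (k + 1) * x a) = z ^ (k + 1) • x := rfl
    rw [hx, hu, hx', mulVec_smul, mulVec_smul, ← smul_add, h1, smul_smul, pow_succ]
  have h2' : ∀ k, S.C.map Complex.ofReal *ᵥ (fun a => z ^ k * x a) +
      S.D.map Complex.ofReal *ᵥ (fun a => z ^ k * u a) = 0 := by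
    intro k
    have hx : (fun a => z ^ k * x a) = z ^ k • x := rfl
    have hu : (fun a => z ^ k * u a) = z ^ k • u := rfl
    rw [hx, hu, mulVec_smul, mulVec_smul, ← smul_add, h2, smul_zero]
  refine ⟨⟨fun k _ => ?_, fun k _ => ?_⟩, ⟨fun k _ => ?_, fun k _ => ?_⟩⟩ <;> ext a
  · rw [Pi.add_apply, ← re_map_ofReal_mulVec, ← re_map_ofReal_mulVec, ← Complex.add_re]
    exact congrArg Complex.re (congrFun (h1' k) a).symm
  · rw [Pi.add_apply, ← re_map_ofReal_mulVec, ← re_map_ofReal_mulVec, ← Complex.add_re]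
    exact congrArg Complex.re (congrFun (h2' k) a)
  · rw [Pi.add_apply, ← im_map_ofReal_mulVec, ← im_map_ofReal_mulVec, ← Complex.add_im]
    exact congrArg Complex.im (congrFun (h1' k) a).symm
  · rw [Pi.add_apply, ← im_map_ofReal_mulVec, ← im_map_ofReal_mulVec, ← Complex.add_im]
    exact congrArg Complex.im (congrFun (h2' k) a)

end LTISystem

/-! ### Error propagation -/

theorem pastRows_mulVec {ℓ d N L : ℕ} (w : Fin ℓ → Fin d → ℝ)
    (g : Fin (ℓ + 1 - (N + L + 1)) → ℝ) :
    pastRows N L w *ᵥ g = fun r => hankelSignal (N + L + 1) w g r.1 r.2 := by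
  ext ⟨i, a⟩
  simp only [hankelSignal, show (i : ℕ) < N + L + 1 by omega, dif_pos]
  rfl

theorem presentRow_mulVec {ℓ d N L : ℕ} (w : Fin ℓ → Fin d → ℝ)
    (g : Fin (ℓ + 1 - (N + L + 1)) → ℝ) :
    presentRow N L w *ᵥ g = hankelSignal (N + L + 1) w g N := by
  ext a
  simp only [hankelSignal, show N < N + L + 1 by omega, dif_pos]
  rfl

section ErrorMatrix

variable {n m p ℓ N L L₀ : ℕ} {S : LTISystem n m p} {xd : Fin ℓ → Fin n → ℝ}
  {ud : Fin ℓ → Fin m → ℝ} {yd : Fin ℓ → Fin p → ℝ}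

theorem inputGain_mulVec_pastRows (hobs : S.IsObservable) (hinv : S.IsDelayInvertible L₀)
    (hN : n ≤ N) (hL : L₀ ≤ L) (htraj : S.IsTrajectory xd ud yd)
    {g : Fin (ℓ + 1 - (N + L + 1)) → ℝ} (hg : hankel (N + L + 1) yd *ᵥ g = 0) :
    inputGain N L ud yd *ᵥ (pastRows N L ud *ᵥ g) = presentRow N L ud *ᵥ g := by
  set Y := hankel (N + L + 1) yd with hY
  set X := pastRows N L ud * kerProj Y with hX
  have hXg : X *ᵥ g = pastRows N L ud *ᵥ g := by rw [hX, ← mulVec_mulVec, kerProj_mulVec hg]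
  -- Both the pseudoinverse solution and `g` produce zero output and the same past inputs. Their
  -- difference has zero past, hence zero initial state and zero present input.
  set g' := kerProj Y *ᵥ (pinv X *ᵥ (X *ᵥ g)) - g with hg'
  have hYg' : Y *ᵥ g' = 0 := by
    rw [hg', mulVec_sub, mulVec_mulVec, mul_kerProj, zero_mulVec, hg, sub_zero]
  have hpast : pastRows N L ud *ᵥ g' = 0 := by
    rw [hg', mulVec_sub, mulVec_mulVec, ← hX, mulVec_mulVec, mulVec_mulVec,
      (pinv_spec X).mul_mul_self, hXg, sub_self]
  have hnull := htraj.isNullTrajectory_hankelSignal hYg'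
  have hu : ∀ k < N, hankelSignal (N + L + 1) ud g' k = 0 := by
    intro k hk
    ext a
    rw [pastRows_mulVec] at hpast
    exact congrFun hpast (⟨k, hk⟩, a)
  have hx := hnull.initial_eq_zero hobs (by omega) fun k hk => hu k (by omega)
  have hpres : presentRow N L ud *ᵥ g' = 0 := by
    rw [presentRow_mulVec]
    exact (hnull.eq_zero_of_initial hinv hx N (by omega)).2
  rw [inputGain, ← hY, ← hX, ← hXg, ← sub_eq_zero, ← hpres, hg', mulVec_sub, mulVec_mulVec,
    mulVec_mulVec, mulVec_mulVec, mulVec_mulVec]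

theorem inputGain_mulVec_of_isNullTrajectory (hmin : S.IsMinimal) (hinv : S.IsDelayInvertible L₀)
    (hN : n ≤ N) (hL : L₀ ≤ L) (htraj : S.IsTrajectory xd ud yd)
    (hPE : PersistentlyExciting (n + (N + L + 1)) ud) {x : ℕ → Fin n → ℝ} {u : ℕ → Fin m → ℝ}
    (h : S.IsNullTrajectory (N + L + 1) x u) :
    inputGain N L ud yd *ᵥ (fun r => u r.1 r.2) = u N := by
  obtain ⟨g, hg, hu⟩ := htraj.exists_hankelSignal_eq hmin.2 hPE h
  have h1 := inputGain_mulVec_pastRows hmin.1 hinv hN hL htraj hg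
  rw [pastRows_mulVec, presentRow_mulVec, hu N (by omega)] at h1
  rw [← h1]
  congr 1
  ext r
  rw [hu r.1 (by omega)]

/-- The orthogonal projector onto the past inputs of the zero-output trajectories. -/
noncomputable def pastProj (N L : ℕ) (ud : Fin ℓ → Fin m → ℝ) (yd : Fin ℓ → Fin p → ℝ) :
    Matrix (Fin N × Fin m) (Fin N × Fin m) ℝ :=
  pastRows N L ud * kerProj (hankel (N + L + 1) yd) *
    pinv (pastRows N L ud * kerProj (hankel (N + L + 1) yd))

/-- Consequently the gain vanishes on the kernel of `pastProj`. -/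
theorem inputGain_mul_pastProj : inputGain N L ud yd * pastProj N L ud yd =
    inputGain N L ud yd := by
  rw [inputGain, pastProj, Matrix.mul_assoc, ← Matrix.mul_assoc (pinv _), (pinv_spec _).inv_mul_mul]

/-- The space of past inputs of zero-output trajectories is invariant: the image is the past of a
trajectory extended by one step and then shifted. -/
theorem errorMatrix_mulVec_pastRows (hmin : S.IsMinimal) (hinv : S.IsDelayInvertible L₀)
    (hN : n ≤ N) (hL : L₀ ≤ L) (htraj : S.IsTrajectory xd ud yd)
    (hPE : PersistentlyExciting (n + (N + L + 1)) ud)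
    {g : Fin (ℓ + 1 - (N + L + 1)) → ℝ} (hg : hankel (N + L + 1) yd *ᵥ g = 0) :
    ∃ g', hankel (N + L + 1) yd *ᵥ g' = 0 ∧
      errorMatrix N L ud yd *ᵥ (pastRows N L ud *ᵥ g) = pastRows N L ud *ᵥ g' := by
  have hnull := htraj.isNullTrajectory_hankelSignal hg
  obtain ⟨x', u', hext, hx'⟩ := hnull.exists_extension (by omega)
  -- The extension may use other inputs near the end, but the common initial state forces agreement
  -- up to time `N`.
  have hu' : ∀ k ≤ N, u' k = hankelSignal (N + L + 1) ud g k := by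
    intro k hk
    have h1 := ((hext.mono (by omega)).sub hnull).eq_zero_of_initial hinv
      (by rw [Pi.sub_apply, hx', sub_self]) k (by omega)
    exact sub_eq_zero.mp h1.2
  obtain ⟨g', hg', hu⟩ := htraj.exists_hankelSignal_eq hmin.2 hPE hext.shift
  refine ⟨g', hg', ?_⟩
  ext ⟨i, a⟩
  have h1 := map_blockCompanion_mulVec (RingHom.id ℝ) (inputGain N L ud yd)
    (pastRows N L ud *ᵥ g) i a
  simp only [RingHom.coe_id, Matrix.map_id] at h1
  rw [errorMatrix, h1]
  simp only [inputGain_mulVec_pastRows hmin.1 hinv hN hL htraj hg]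
  rw [presentRow_mulVec, pastRows_mulVec, pastRows_mulVec]
  dsimp only
  rw [hu i (by omega), hu' _ (by omega)]
  split_ifs with h
  · rfl
  · rw [show (i : ℕ) + 1 = N by omega]

theorem pastProj_mul_errorMatrix_mul_pastProj (hmin : S.IsMinimal) (hinv : S.IsDelayInvertible L₀)
    (hN : n ≤ N) (hL : L₀ ≤ L) (htraj : S.IsTrajectory xd ud yd)
    (hPE : PersistentlyExciting (n + (N + L + 1)) ud) :
    pastProj N L ud yd * (errorMatrix N L ud yd * pastProj N L ud yd) =
      errorMatrix N L ud yd * pastProj N L ud yd := by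
  apply Matrix.mulVec_injective
  funext v
  rw [← mulVec_mulVec]
  set X := pastRows N L ud * kerProj (hankel (N + L + 1) yd) with hX
  obtain ⟨g', hg', h1⟩ := errorMatrix_mulVec_pastRows hmin hinv hN hL htraj hPE
    (g := kerProj (hankel (N + L + 1) yd) *ᵥ (pinv X *ᵥ v))
    (by rw [mulVec_mulVec, mul_kerProj, zero_mulVec])
  have h2 : (errorMatrix N L ud yd * pastProj N L ud yd) *ᵥ v = X *ᵥ g' := by
    rw [hX, ← mulVec_mulVec _ (pastRows _ _ _), kerProj_mulVec hg', ← h1, pastProj, ← hX,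
      ← mulVec_mulVec, ← mulVec_mulVec]
    congr 1
    rw [hX, ← mulVec_mulVec _ (pastRows _ _ _), ← hX]
  rw [h2, pastProj, ← hX, mulVec_mulVec, (pinv_spec X).mul_mul_self]

theorem mem_eigenvalueSet_errorMatrix_of_isInvariantZero (hmin : S.IsMinimal)
    (hinv : S.IsDelayInvertible L₀) (hN : n ≤ N) (hL : L₀ ≤ L) (htraj : S.IsTrajectory xd ud yd)
    (hPE : PersistentlyExciting (n + (N + L + 1)) ud) {z : ℂ} (hz : S.IsInvariantZero z) :
    z ∈ eigenvalueSet (errorMatrix N L ud yd) := by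
  obtain ⟨x, u, hne, h1, h2⟩ := LTISystem.isInvariantZero_iff.mp hz
  obtain ⟨hre, him⟩ := LTISystem.isNullTrajectory_pow h1 h2 (N + L + 1)
  rw [eigenvalueSet, mem_spectrum_iff_exists_mulVec_eq_smul]
  refine ⟨fun r => z ^ (r.1 : ℕ) * u r.2, fun hv => hne ?_, ?_⟩
  -- If these inputs vanished, observability would give `x = 0` and the delayed inverse `u = 0`.
  · have hv' : ∀ k < N, ∀ a, z ^ k * u a = 0 := fun k hk a => congrFun hv (⟨k, hk⟩, a)
    have hx : ∀ a, x a = 0 := by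
      intro a
      apply Complex.ext
      · simpa using congrFun (hre.initial_eq_zero hmin.1 (by omega) fun k hk => by
          ext a; simp [hv' k (by omega)]) a
      · simpa using congrFun (him.initial_eq_zero hmin.1 (by omega) fun k hk => by
          ext a; simp [hv' k (by omega)]) a
    refine ⟨funext hx, funext fun a => Complex.ext ?_ ?_⟩
    · simpa using congrFun (hre.input_zero_eq_zero hinv (by omega) (by ext a; simp [hx])) a
    · simpa using congrFun (him.input_zero_eq_zero hinv (by omega) (by ext a; simp [hx])) a
  · ext ⟨i, a⟩
    refine (map_blockCompanion_mulVec Complex.ofRealHom (inputGain N L ud yd) _ i a).trans ?_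
    have hgain : ((inputGain N L ud yd).map Complex.ofReal *ᵥ
        (fun r => z ^ (r.1 : ℕ) * u r.2)) a = z ^ N * u a := by
      apply Complex.ext
      · rw [re_map_ofReal_mulVec]
        exact congrFun
          (inputGain_mulVec_of_isNullTrajectory hmin hinv hN hL htraj hPE hre) a
      · rw [im_map_ofReal_mulVec]
        exact congrFun
          (inputGain_mulVec_of_isNullTrajectory hmin hinv hN hL htraj hPE him) a
    have hval : z ^ ((i : ℕ) + 1) * u a = z * (z ^ (i : ℕ) * u a) := by ring
    split_ifs with h
    · exact hval
    · rw [show (i : ℕ) + 1 = N by omega] at hval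
      exact hgain.trans hval

theorem isInvariantZero_of_mem_eigenvalueSet_errorMatrix (hmin : S.IsMinimal)
    (hinv : S.IsDelayInvertible L₀) (hN : n ≤ N) (hL : L₀ ≤ L) (htraj : S.IsTrajectory xd ud yd)
    (hPE : PersistentlyExciting (n + (N + L + 1)) ud) {z : ℂ} (hz : 1 ≤ ‖z‖)
    (hmem : z ∈ eigenvalueSet (errorMatrix N L ud yd)) : S.IsInvariantZero z := by
  obtain ⟨v, hne, hv⟩ := mem_spectrum_iff_exists_mulVec_eq_smul.mp hmem
  change (blockCompanion (inputGain N L ud yd)).map Complex.ofRealHom *ᵥ v = z • v at hv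
  set P := pastProj N L ud yd with hP
  set Y := hankel (N + L + 1) yd with hY
  set X := pastRows N L ud * kerProj Y with hX
  have hPt : Pᵀ = P := (pinv_spec X).symm_left
  have hPP : P * P = P := by
    rw [hP, pastProj, ← hY, ← hX, ← Matrix.mul_assoc, (pinv_spec X).mul_mul_self]
  have hGP : ∀ w, P.map Complex.ofRealHom *ᵥ w = 0 →
      (inputGain N L ud yd).map Complex.ofRealHom *ᵥ w = 0 := by
    intro w hw
    rw [← inputGain_mul_pastProj, Matrix.map_mul, ← mulVec_mulVec, hw, mulVec_zero]
  -- The only use of `1 ≤ ‖z‖`: the eigenvector is the past of a complex zero-output trajectory,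
  -- handled below through its real and imaginary parts.
  have hPv : P.map Complex.ofRealHom *ᵥ v = v := by
    refine mulVec_eq_self_of_one_le_norm ?_ ?_ ?_
      (fun w hw => sum_norm_sq_map_blockCompanion_mulVec_le (hGP w hw))
      (fun w z hw hz h => eq_zero_of_map_blockCompanion_mulVec_eq_smul (hGP w hw) hz h) hz hv
    · ext i j
      simpa using congrFun (congrFun hPt i) j
    · rw [← Matrix.map_mul, hPP]
    · rw [← Matrix.map_mul, ← Matrix.map_mul]
      exact congrArg (fun M => M.map Complex.ofRealHom)
        (pastProj_mul_errorMatrix_mul_pastProj hmin hinv hN hL htraj hPE)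
  have hPX : P = pastRows N L ud * (kerProj Y * pinv X) := by
    rw [hP, pastProj, ← hY, ← hX, hX, Matrix.mul_assoc]
  set gr := (kerProj Y * pinv X) *ᵥ fun r => (v r).re with hgr
  set gi := (kerProj Y * pinv X) *ᵥ fun r => (v r).im with hgi
  have hYr : Y *ᵥ gr = 0 := by
    rw [hgr, mulVec_mulVec, ← Matrix.mul_assoc, mul_kerProj, Matrix.zero_mul, zero_mulVec]
  have hYi : Y *ᵥ gi = 0 := by
    rw [hgi, mulVec_mulVec, ← Matrix.mul_assoc, mul_kerProj, Matrix.zero_mul, zero_mulVec]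
  have hpr : pastRows N L ud *ᵥ gr = fun r => (v r).re := by
    rw [hgr, mulVec_mulVec, ← hPX]
    ext r
    exact (re_map_ofReal_mulVec P v r).symm.trans (congrArg Complex.re (congrFun hPv r))
  have hpi : pastRows N L ud *ᵥ gi = fun r => (v r).im := by
    rw [hgi, mulVec_mulVec, ← hPX]
    ext r
    exact (im_map_ofReal_mulVec P v r).symm.trans (congrArg Complex.im (congrFun hPv r))
  have hGr := inputGain_mulVec_pastRows hmin.1 hinv hN hL htraj hYr
  have hGi := inputGain_mulVec_pastRows hmin.1 hinv hN hL htraj hYi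
  rw [presentRow_mulVec, hpr] at hGr
  rw [presentRow_mulVec, hpi] at hGi
  have hnr := htraj.isNullTrajectory_hankelSignal hYr
  have hni := htraj.isNullTrajectory_hankelSignal hYi
  rw [pastRows_mulVec] at hpr hpi
  set xr := hankelSignal (N + L + 1) xd gr
  set xi := hankelSignal (N + L + 1) xd gi
  set ur := hankelSignal (N + L + 1) ud gr
  set ui := hankelSignal (N + L + 1) ud gi
  have hur : ∀ (k : Fin N) a, ur k a = (v (k, a)).re := fun k a => congrFun hpr (k, a)
  have hui : ∀ (k : Fin N) a, ui k a = (v (k, a)).im := fun k a => congrFun hpi (k, a)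
  have hstep : ∀ (k : Fin N) a, ur (k + 1) a = (z * v (k, a)).re ∧
      ui (k + 1) a = (z * v (k, a)).im := by
    intro k a
    have h1 := congrFun hv (k, a)
    rw [map_blockCompanion_mulVec] at h1
    change _ = z * v (k, a) at h1
    rw [← h1]
    split_ifs with h
    · exact ⟨hur ⟨k + 1, h⟩ a, hui ⟨k + 1, h⟩ a⟩
    · rw [show (k : ℕ) + 1 = N by omega, ← hGr, ← hGi]
      exact ⟨(re_map_ofReal_mulVec _ v a).symm, (im_map_ofReal_mulVec _ v a).symm⟩
  -- The shifted trajectory minus `z` times the original has zero output and zero inputs at times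
  -- before `N`. Its initial state is therefore zero, which says that the complex state at time 1 is
  -- `z` times the one at time 0.
  have hxr := ((hnr.shift (s := 1)).sub (((hnr.mono (by omega)).smul z.re).sub
    ((hni.mono (by omega)).smul z.im))).initial_eq_zero hmin.1 (by omega) fun k hk => by
      ext a
      have h1 := (hstep ⟨k, by omega⟩ a).1
      rw [Complex.mul_re, ← hur, ← hui] at h1
      simpa [sub_eq_zero] using h1
  have hxi := ((hni.shift (s := 1)).sub (((hni.mono (by omega)).smul z.re).add
    ((hnr.mono (by omega)).smul z.im))).initial_eq_zero hmin.1 (by omega) fun k hk => by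
      ext a
      have h1 := (hstep ⟨k, by omega⟩ a).2
      rw [Complex.mul_im, ← hur, ← hui] at h1
      simpa [sub_eq_zero] using h1
  have hN0 : 0 < N := by
    by_contra h0
    obtain rfl : N = 0 := by omega
    exact hne (funext fun r => r.1.elim0)
  refine LTISystem.isInvariantZero_iff.mpr
    ⟨fun a => ⟨xr 0 a, xi 0 a⟩, fun a => v (⟨0, hN0⟩, a), fun h0 => hne ?_, ?_, ?_⟩
  -- Each block of `v` is `z` times the preceding one, so a zero first block would make `v` vanish.
  · have hv0 : ∀ k (hk : k < N) a, v (⟨k, hk⟩, a) = 0 := by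
      intro k
      induction k with
      | zero => exact fun _ a => congrFun h0.2 a
      | succ k ih =>
        intro hk a
        have h1 := congrFun hv (⟨k, by omega⟩, a)
        rw [map_blockCompanion_mulVec, dif_pos hk] at h1
        rw [h1, Pi.smul_apply, ih, smul_zero]
    exact funext fun r => hv0 r.1 r.1.2 r.2
  · have hsr := hnr.state 0 (by omega)
    have hsi := hni.state 0 (by omega)
    have hur0 : ur 0 = fun a => (v (⟨0, hN0⟩, a)).re := funext fun a => hur ⟨0, hN0⟩ a
    have hui0 : ui 0 = fun a => (v (⟨0, hN0⟩, a)).im := funext fun a => hui ⟨0, hN0⟩ a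
    ext a
    have hra := congrFun hxr a
    have hia := congrFun hxi a
    simp only [Pi.sub_apply, Pi.add_apply, Pi.smul_apply, Pi.zero_apply, smul_eq_mul, zero_add,
      hsr, hsi, hur0, hui0] at hra hia
    apply Complex.ext
    · rw [Pi.add_apply, Complex.add_re, re_map_ofReal_mulVec, re_map_ofReal_mulVec, Pi.smul_apply,
        smul_eq_mul, Complex.mul_re]
      linarith
    · rw [Pi.add_apply, Complex.add_im, im_map_ofReal_mulVec, im_map_ofReal_mulVec, Pi.smul_apply,
        smul_eq_mul, Complex.mul_im]
      linarith
  · have hor := hnr.output 0 (by omega)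
    have hoi := hni.output 0 (by omega)
    have hur0 : ur 0 = fun a => (v (⟨0, hN0⟩, a)).re := funext fun a => hur ⟨0, hN0⟩ a
    have hui0 : ui 0 = fun a => (v (⟨0, hN0⟩, a)).im := funext fun a => hui ⟨0, hN0⟩ a
    rw [hur0] at hor
    rw [hui0] at hoi
    ext a
    apply Complex.ext
    · rw [Pi.add_apply, Complex.add_re, re_map_ofReal_mulVec, re_map_ofReal_mulVec]
      exact congrFun hor a
    · rw [Pi.add_apply, Complex.add_im, im_map_ofReal_mulVec, im_map_ofReal_mulVec]
      exact congrFun hoi a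

end ErrorMatrix

end InputEstimation

/-! ### The main theorem. -/

open InputEstimation
theorem theorem1 {n m p : ℕ} (S : LTISystem n m p) (hmin : S.IsMinimal)
    (L₀ : ℕ) (hL₀ : L₀ ≤ n) (hinv : S.IsDelayInvertible L₀)
    (N L T : ℕ) (hN : n ≤ N) (hL : L₀ ≤ L)
    (xd : Fin (T + N + L + 1) → Fin n → ℝ)
    (ud : Fin (T + N + L + 1) → Fin m → ℝ)
    (yd : Fin (T + N + L + 1) → Fin p → ℝ)
    (htraj : S.IsTrajectory xd ud yd)
    (hPE : PersistentlyExciting (n + N + L + 1) ud) :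
    (IsSchurStable (errorMatrix N L ud yd) ↔ ∀ z : ℂ, S.IsInvariantZero z → ‖z‖ < 1) ∧
      ∃ Λ : Set ℂ, (∀ z ∈ Λ, ‖z‖ < 1) ∧
        eigenvalueSet (errorMatrix N L ud yd) = {z : ℂ | S.IsInvariantZero z} ∪ Λ := by
  rw [show n + N + L + 1 = n + (N + L + 1) by omega] at hPE
  have hsub : ∀ z : ℂ, S.IsInvariantZero z → z ∈ eigenvalueSet (errorMatrix N L ud yd) :=
    fun z hz => mem_eigenvalueSet_errorMatrix_of_isInvariantZero hmin hinv hN hL htraj hPE hz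
  have hsup : ∀ z ∈ eigenvalueSet (errorMatrix N L ud yd), S.IsInvariantZero z ∨ ‖z‖ < 1 :=
    fun z hz => (lt_or_ge ‖z‖ 1).symm.imp_left fun h =>
      isInvariantZero_of_mem_eigenvalueSet_errorMatrix hmin hinv hN hL htraj hPE h hz
  refine ⟨⟨fun h z hz => h z (hsub z hz), fun h z hz => (hsup z hz).elim (h z) id⟩,
    -- All eigenvalues in the open disc are taken; the union need not be disjoint, so stable
    -- invariant zeros may occur in both sets.
    {z ∈ eigenvalueSet (errorMatrix N L ud yd) | ‖z‖ < 1}, fun z hz => hz.2, ?_⟩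
  ext z
  constructor
  · exact fun hz => (hsup z hz).imp id fun h => ⟨hz, h⟩
  · rintro (hz | hz)
    · exact hsub z hz
    · exact hz.1
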